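/- Let $G$ be a finite simple graph on a non-empty vertex set $V$ (every such graph is the confusability graph of some classical channel with input alphabet $V$), identified with the operator space $\operatorname{span}\{|i\rangle\langle j| : i=j \text{ or } i\sim j\}$ of complex $V\times V$ matrices. A *cq-graph* with input alphabet $V$ and finite-dimensional output space $B$ is a space $K\subseteq \mathcal L(\mathbb C^V,B)$ that is the linear span of the Kraus operators of a classical-quantum channel $\rho\mapsto\sum_{i\in V}\langle i|\rho|i\rangle\,\sigma_i$, where the $\sigma_i$ are density operators on $B$. With $A=\mathbb C^V$, let $P_{AB}$ be the orthogonal projection onto the span of the Choi vectors $\sum_{i}|i\rangle\otimes E|i\rangle$, $E\in K$ (the support of the Choi–Jamiołkowski matrix of the channel). Put $$\Upsilon(K)=\max\{\operatorname{Tr}S_A : 0\le U_{AB}\le S_A\otimes 1_B,\ \operatorname{Tr}_AU_{AB}=1_B,\ \operatorname{Tr}P_{AB}(S_A\otimes 1_B-U_{AB})=0\},$$ $$\mathsf A(K)=\max\{\operatorname{Tr}S_A : S_A\ge 0,\ \operatorname{Tr}_A P_{AB}(S_A\otimes 1_B)\le 1_B\},$$ let $K^\dagger K=\operatorname{span}\{X^\dagger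 Y: X,Y\in K\}$, and let $$\Upsilon(G)=\min\{\Upsilon(K): K \text{ a cq-graph with } K^\dagger K\subseteq G\}$$ (the minimum running over all finite output dimensions). Let $\vartheta(G)$ be the Lovász number: the minimum of $\max_{i\in V} \langle c,u_i\rangle^{-2}$ over all families of real unit vectors $(u_i)_{i\in V}$, with $u_i\perp u_j$ for distinct non-adjacent $i,j$, and all unit vectors $c$. Let $G_1,G_2$ be finite simple graphs on non-empty vertex sets, and let $G_1\oplus G_2$ be their disjoint union. Then for $k=1,2$ $$\vartheta(G_k)=\min\{\mathsf A(K): K\text{ a cq-graph with }K^\dagger K\subseteq G_k\},$$ the minimum defining $\Upsilon(G_1\oplus G_2)$ is attained, and $$\Upsilon(G_1\oplus G_2)=\vartheta(G_1)+\vartheta(G_2).$$ -/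

import Mathlib

open scoped ComplexOrder Kronecker

noncomputable section

namespace ZeroError

variable {A B : Type*} [Fintype A] [DecidableEq A] [Fintype B] [DecidableEq B]

/-- The partial trace over the first tensor factor. -/
def traceA (M : Matrix (A × B) (A × B) ℂ) : Matrix B B ℂ :=
  Matrix.of fun b b' => ∑ a, M (a, b) (a, b')

/-- The Choi vector `∑ₐ |a⟩ ⊗ E|a⟩` of an operator `E : ℂ^A → ℂ^B`, as a linear map in `E`. -/
def choiVec : Matrix B A ℂ →ₗ[ℂ] EuclideanSpace ℂ (A × B) where
  toFun E := WithLp.toLp 2 fun p => E p.2 p.1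
  map_add' _ _ := rfl
  map_smul' _ _ := rfl

/-- The Choi–Jamiołkowski projection `P_AB` of an operator space `K`: the orthogonal projection onto
the span of the Choi vectors of the operators in `K`. When `K` is spanned by the Kraus operators of
a channel, this is the projection onto the support of the Choi–Jamiołkowski matrix. -/
def choiProjection (K : Submodule ℂ (Matrix B A ℂ)) : Matrix (A × B) (A × B) ℂ :=
  Matrix.toEuclideanCLM (𝕜 := ℂ) (n := A × B) |>.symm (K.map choiVec).starProjection

/-- Feasibility of `(S_A, U_AB)` in the semidefinite program for the one-shot no-signalling assisted
zero-error capacity of `K`. -/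
def UpsilonFeasible (K : Submodule ℂ (Matrix B A ℂ))
    (S : Matrix A A ℂ) (U : Matrix (A × B) (A × B) ℂ) : Prop :=
  U.PosSemidef ∧ (S ⊗ₖ (1 : Matrix B B ℂ) - U).PosSemidef ∧ traceA U = 1 ∧
    (choiProjection K * (S ⊗ₖ (1 : Matrix B B ℂ) - U)).trace = 0

/-- `Υ(K)`, the one-shot no-signalling assisted zero-error classical capacity (as a number of
messages) of a non-commutative bipartite graph `K`. -/
def upsilon (K : Submodule ℂ (Matrix B A ℂ)) : ℝ :=
  sSup {x | ∃ S U, UpsilonFeasible K S U ∧ x = S.trace.re}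

/-- The semidefinite (fractional) packing number of a non-commutative bipartite graph `K`. -/
def packingNumber (K : Submodule ℂ (Matrix B A ℂ)) : ℝ :=
  sSup {x | ∃ S : Matrix A A ℂ, S.PosSemidef ∧
    (1 - traceA (choiProjection K * (S ⊗ₖ (1 : Matrix B B ℂ)))).PosSemidef ∧ x = S.trace.re}

/-- `K` is a cq-graph: the linear span of the Kraus operators `E k` of a classical-quantum channel
`ρ ↦ ∑ₐ ⟨a|ρ|a⟩ σₐ`, where the `σₐ` are density matrices. -/
def IsCQGraph (K : Submodule ℂ (Matrix B A ℂ)) : Prop :=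
  ∃ σ : A → Matrix B B ℂ, (∀ a, (σ a).PosSemidef ∧ (σ a).trace = 1) ∧
    ∃ (n : ℕ) (E : Fin n → Matrix B A ℂ),
      (∀ ρ : Matrix A A ℂ, ∑ k, E k * ρ * (E k).conjTranspose = ∑ a, ρ a a • σ a) ∧
      K = Submodule.span ℂ (Set.range E)

/-- The operator space `K†K`, spanned by the products `X†Y` with `X, Y ∈ K`. -/
def adjointProduct (K : Submodule ℂ (Matrix B A ℂ)) : Submodule ℂ (Matrix A A ℂ) :=
  Submodule.span ℂ {Z | ∃ X ∈ K, ∃ Y ∈ K, Z = X.conjTranspose * Y}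

/-- The operator space of a graph, spanned by the matrix units `|i⟩⟨j|` with `i = j` or `i ~ j`. -/
def graphSpace {V : Type*} [DecidableEq V] (G : SimpleGraph V) : Submodule ℂ (Matrix V V ℂ) :=
  Submodule.span ℂ {Z | ∃ i j, (i = j ∨ G.Adj i j) ∧ Z = Matrix.single i j 1}

section Graph

variable {V : Type*} [Fintype V] [DecidableEq V]

/-- The values `Υ(K)` over all cq-graphs `K`, of any finite output dimension, with `K†K ⊆ G`. -/
def upsilonValues (G : SimpleGraph V) : Set ℝ :=
  {x | ∃ (d : ℕ) (K : Submodule ℂ (Matrix (Fin d) V ℂ)),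
    IsCQGraph K ∧ adjointProduct K ≤ graphSpace G ∧ x = upsilon K}

/-- The semidefinite packing numbers of all cq-graphs `K`, of any finite output dimension, with
`K†K ⊆ G`. -/
def packingValues (G : SimpleGraph V) : Set ℝ :=
  {x | ∃ (d : ℕ) (K : Submodule ℂ (Matrix (Fin d) V ℂ)),
    IsCQGraph K ∧ adjointProduct K ≤ graphSpace G ∧ x = packingNumber K}

/-- `Υ(G)`, the minimum of `Υ(K)` over all cq-graphs `K` with `K†K ⊆ G`. -/
def graphUpsilon (G : SimpleGraph V) : ℝ := sInf (upsilonValues G)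

end Graph

/-- An orthonormal representation of a graph: unit vectors, orthogonal at distinct non-adjacent
vertices. -/
def IsOrthonormalRep {V : Type*} (G : SimpleGraph V) {d : ℕ}
    (u : V → EuclideanSpace ℝ (Fin d)) : Prop :=
  (∀ i, ‖u i‖ = 1) ∧ ∀ i j, i ≠ j → ¬ G.Adj i j → inner ℝ (u i) (u j) = 0

/-- The Lovász number: the minimum, over all orthonormal representations `u` and all unit vectors
`c`, of `maxᵢ 1 / ⟨c, uᵢ⟩²` (pairs with some `⟨c, uᵢ⟩ = 0` have value `∞` and are left out). -/
def lovaszTheta {V : Type*} (G : SimpleGraph V) : ℝ :=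
  sInf {t | ∃ (d : ℕ) (u : V → EuclideanSpace ℝ (Fin d)) (c : EuclideanSpace ℝ (Fin d)),
    IsOrthonormalRep G u ∧ ‖c‖ = 1 ∧ (∀ i, inner ℝ c (u i) ≠ 0) ∧
    t = ⨆ i, 1 / (inner ℝ c (u i)) ^ 2}

end ZeroError

end

/-! The Choi projection of a cq-graph `K` is block diagonal, with one non-zero projection `P a` on
the output space per input symbol, and `K†K ⊆ G` makes `P a` and `P a'` orthogonal whenever `a ≠ a'`
are non-adjacent. Only diagonal blocks matter in either program. The packing number maximises `∑ s
a` subject to `∑ s a • P a ≤ 1`; `Υ(K)` asks in addition for a resolution of the identity `∑ N a =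
1` with `0 ≤ N a ≤ s a` and `P a * N a = s a • P a`. Hence `Υ(K) ≤ A(K)`.

Packing and the Lovász number are dual. By Hahn–Banach, either some state `T = X X†` has `Tr (P a *
T) ≥ 1/α` for all `a`, or some packing has weight above `α` (`exists_state_or_exists_packing`). A
state of the first kind yields an orthonormal representation, the normalised `P a * X` with handle
`X`, so `ϑ(G) ≤ α`; hence `ϑ(G) ≤ A(K)`. An optimal representation, read as a family of pure output
states, gives equality (`exists_cqGraph_packingNumber_le`).

In a disjoint union the blocks of the two parts live on complementary subspaces `1 - Q` and `Q`. A
packing of one part may leave some of its subspace unfilled; that remainder is orthogonal to every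
block of the other part, so it can be shared among the operators `N` of the other part without
spoiling `P * N = s • P`. Two packings of weight at least 1 thus fill each other's gaps
(`IsCQGraph.add_le_upsilon`), so `ϑ(G₁) + ϑ(G₂) ≤ Υ(K)`. The reverse bound, for an optimal `K`, is
the chain `Υ(K) ≤ A(K) ≤ ϑ(G₁ ⊕ G₂) ≤ ϑ(G₁) + ϑ(G₂)`. -/

namespace ZeroError

open Matrix

/-! ### Orthogonal projections as matrices -/

section ProjectionMatrix

variable {n : Type*} [Fintype n] [DecidableEq n] (F : Submodule ℂ (EuclideanSpace ℂ n))

/-- The matrix of the orthogonal projection onto a subspace. -/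
noncomputable def projectionMatrix : Matrix n n ℂ :=
  Matrix.toEuclideanCLM (𝕜 := ℂ) (n := n) |>.symm F.starProjection

theorem projectionMatrix_mul_self :
    projectionMatrix F * projectionMatrix F = projectionMatrix F := by
  unfold projectionMatrix
  rw [← map_mul]
  exact congrArg _ (Submodule.isIdempotentElem_starProjection _)

set_option synthInstance.maxHeartbeats 200000 in
theorem projectionMatrix_isHermitian : (projectionMatrix F).IsHermitian := by
  unfold projectionMatrix
  rw [Matrix.IsHermitian, ← Matrix.star_eq_conjTranspose]
  have h := map_star (F := (_ ≃⋆ₐ[ℂ] _)) (Matrix.toEuclideanCLM (𝕜 := ℂ) (n := n)).symm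
    F.starProjection
  rw [← h]
  exact congrArg _ (isSelfAdjoint_starProjection _)

theorem projectionMatrix_mulVec (v : n → ℂ) :
    projectionMatrix F *ᵥ v = (F.starProjection (WithLp.toLp 2 v)).ofLp := by
  have h := ofLp_toEuclideanCLM (𝕜 := ℂ) (projectionMatrix F) (WithLp.toLp 2 v)
  rw [← h, projectionMatrix, StarAlgEquiv.apply_symm_apply]

/-- Two mutually orthogonal families of matrices are separated by a projection. -/
theorem exists_projection_separating {ι κ : Type*} {P : ι → Matrix n n ℂ} {R : κ → Matrix n n ℂ}
    (hR : ∀ j i, R j * P i = 0) :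
    ∃ Q : Matrix n n ℂ, Q.IsHermitian ∧ Q * Q = Q ∧ (∀ i, Q * P i = P i) ∧ ∀ j, R j * Q = 0 := by
  -- The sum of the ranges of the `P i`: each `R j` vanishes on it because it does so on generators.
  let F : Submodule ℂ (EuclideanSpace ℂ n) :=
    Submodule.span ℂ {x | ∃ i v, x = WithLp.toLp 2 (P i *ᵥ v)}
  refine ⟨projectionMatrix F, projectionMatrix_isHermitian F, projectionMatrix_mul_self F,
    fun i => ?_, fun j => ?_⟩
  · refine Matrix.ext_of_mulVec_single fun k => ?_
    rw [← mulVec_mulVec, projectionMatrix_mulVec]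
    have hmem : WithLp.toLp 2 (P i *ᵥ Pi.single k 1) ∈ F := Submodule.subset_span ⟨i, _, rfl⟩
    exact congrArg WithLp.ofLp (Submodule.starProjection_eq_self_iff.2 hmem)
  · refine Matrix.ext_of_mulVec_single fun k => ?_
    rw [← mulVec_mulVec, projectionMatrix_mulVec, zero_mulVec]
    have hF : ∀ x ∈ F, R j *ᵥ x.ofLp = 0 := by
      intro x hx
      induction hx using Submodule.span_induction with
      | mem x hx =>
        obtain ⟨i, v, rfl⟩ := hx
        rw [mulVec_mulVec, hR, zero_mulVec]
      | zero => simp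
      | add x y _ _ hx hy => simp [mulVec_add, hx, hy]
      | smul c x _ hx => simp [mulVec_smul, hx]
    exact hF _ (Submodule.starProjection_apply_mem _ _)

end ProjectionMatrix

/-! ### Block structure of the Choi projection of a cq-graph -/

section Choi

variable {A B : Type*} [Fintype A] [DecidableEq A] [Fintype B] [DecidableEq B]
  (K : Submodule ℂ (Matrix B A ℂ))

theorem choiProjection_mul_self : choiProjection K * choiProjection K = choiProjection K :=
  projectionMatrix_mul_self _

theorem choiProjection_isHermitian : (choiProjection K).IsHermitian :=
  projectionMatrix_isHermitian _

theorem choiProjection_mulVec (v : A × B → ℂ) :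
    choiProjection K *ᵥ v = ((K.map choiVec).starProjection (WithLp.toLp 2 v)).ofLp :=
  projectionMatrix_mulVec _ v

theorem choiProjection_mulVec_of_mem {X : Matrix B A ℂ} (hX : X ∈ K) :
    choiProjection K *ᵥ (fun p => X p.2 p.1) = fun p => X p.2 p.1 := by
  rw [choiProjection_mulVec]
  exact congrArg WithLp.ofLp
    (Submodule.starProjection_eq_self_iff.2 (Submodule.mem_map_of_mem (f := choiVec) hX))

theorem choiProjection_mulVec_mem (v : A × B → ℂ) :
    (Matrix.of fun b a => (choiProjection K *ᵥ v) (a, b)) ∈ K := by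
  rw [choiProjection_mulVec]
  obtain ⟨X, hX, h⟩ := Submodule.starProjection_apply_mem (K.map choiVec) (WithLp.toLp 2 v)
  rw [← h]
  exact hX

/-- The projected vector is itself the Choi vector of an element of `K`, so the hypothesis applied
to that element says that its squared norm is zero. -/
theorem choiProjection_mulVec_eq_zero {v : A × B → ℂ}
    (h : ∀ X ∈ K, star (fun p : A × B => X p.2 p.1) ⬝ᵥ v = 0) : choiProjection K *ᵥ v = 0 := by
  have hv := h _ (choiProjection_mulVec_mem K v)
  have e : (fun p : A × B => (Matrix.of fun b a => (choiProjection K *ᵥ v) (a, b)) p.2 p.1)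
      = choiProjection K *ᵥ v := rfl
  rw [e, star_mulVec, (choiProjection_isHermitian K).eq, ← dotProduct_mulVec] at hv
  rwa [← dotProduct_star_self_eq_zero, star_mulVec,
    (choiProjection_isHermitian K).eq, ← dotProduct_mulVec, mulVec_mulVec,
    choiProjection_mul_self]

/-- The Choi projection of a cq-graph is block diagonal. -/
theorem IsCQGraph.choiProjection_apply_of_ne {K : Submodule ℂ (Matrix B A ℂ)} (hK : IsCQGraph K)
    {a a' : A} (h : a ≠ a') (b b' : B) : choiProjection K (a, b) (a', b') = 0 := by
  obtain ⟨σ, -, n, E, hE, rfl⟩ := hK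
  set K := Submodule.span ℂ (Set.range E)
  set P := choiProjection K
  have hPh : Pᴴ = P := choiProjection_isHermitian K
  let e : Fin n → A × B → ℂ := fun k p => E k p.2 p.1
  -- The Choi matrix of the channel. Its entries are found by feeding in matrix units, and the cq
  -- form makes it block diagonal.
  let M : Matrix (A × B) (A × B) ℂ := ∑ k, vecMulVec (e k) (star (e k))
  have hM : ∀ a a' b b', M (a, b) (a', b') = if a = a' then σ a b b' else 0 := by
    intro a a' b b'
    have h1 := congrFun (congrFun (hE (Matrix.single a a' 1)) b) b'
    simp only [Matrix.sum_apply, Matrix.smul_apply] at h1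
    simp only [M, Matrix.sum_apply, vecMulVec_apply, e]
    convert h1 using 1
    · refine Finset.sum_congr rfl fun k _ => ?_
      simp [Matrix.mul_apply, Matrix.single_apply, ite_and, Finset.sum_ite_eq]
    · by_cases haa : a = a'
      · subst haa
        simp [Matrix.single_apply]
      · simp [Matrix.single_apply, haa]
        refine (Finset.sum_eq_zero fun x _ => ?_).symm
        rw [if_neg]
        rintro ⟨rfl, rfl⟩
        exact haa rfl
  let D : Matrix (A × B) (A × B) ℂ := Matrix.diagonal fun p => if p.1 = a then 1 else 0
  have hMD : M * D = D * M := by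
    ext ⟨x, y⟩ ⟨x', y'⟩
    simp only [D, Matrix.mul_diagonal, Matrix.diagonal_mul, hM]
    by_cases hx : x = x'
    · subst hx; ring
    · simp [hx]
  have hPM : P * M = M := by
    simp only [M, Matrix.mul_sum, mul_vecMulVec]
    refine Finset.sum_congr rfl fun k _ => ?_
    rw [show P *ᵥ e k = e k from choiProjection_mulVec_of_mem K
      (Submodule.subset_span ⟨k, rfl⟩)]
  have hMh : Mᴴ = M := by
    simp [M, Matrix.conjTranspose_sum, conjTranspose_vecMulVec]
  have hMP : M * P = M := by
    have := congrArg Matrix.conjTranspose hPM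
    rwa [conjTranspose_mul, hPh, hMh] at this
  -- If `M v = 0`, then `v† M v = ∑ |⟨e k, v⟩|²` vanishes, so `v` is orthogonal to all Choi vectors.
  have hker : ∀ v, M *ᵥ v = 0 → P *ᵥ v = 0 := by
    intro v hv
    have h0 : ∑ k, star (star (e k) ⬝ᵥ v) * (star (e k) ⬝ᵥ v) = 0 := by
      have : star v ⬝ᵥ (M *ᵥ v) = 0 := by rw [hv, dotProduct_zero]
      rw [← this]
      simp only [M, Matrix.sum_mulVec, dotProduct_sum, vecMulVec_mulVec, dotProduct_smul]
      refine Finset.sum_congr rfl fun k _ => ?_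
      rw [← star_dotProduct]
      simp
    have h1 : ∀ k, star (e k) ⬝ᵥ v = 0 := by
      intro k
      have := (Finset.sum_eq_zero_iff_of_nonneg (fun k _ => star_mul_self_nonneg _)).1 h0 k
        (Finset.mem_univ k)
      simpa using this
    refine choiProjection_mulVec_eq_zero K fun X hX => ?_
    induction hX using Submodule.span_induction with
    | mem x hx => obtain ⟨k, rfl⟩ := hx; exact h1 k
    | zero => simp [dotProduct]
    | add x y _ _ hx hy =>
      refine Eq.trans ?_ ((congrArg₂ (· + ·) hx hy).trans (add_zero 0))
      simp only [← add_dotProduct, ← star_add]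
      rfl
    | smul c x _ hx =>
      rw [← mul_zero (star c), ← hx, ← smul_eq_mul, ← smul_dotProduct, ← star_smul]
      rfl
  -- `D` commutes with `M`, so it preserves the common kernel of `M` and `P`. With the adjoint
  -- identity, `P` commutes with `D`, which kills the blocks off the diagonal.
  have hPD : P * D * (1 - P) = 0 := by
    refine Matrix.ext_of_mulVec_single fun i => ?_
    rw [← mulVec_mulVec, ← mulVec_mulVec, zero_mulVec]
    refine hker _ ?_
    rw [mulVec_mulVec, hMD, ← mulVec_mulVec, mulVec_mulVec _ M, mul_sub, mul_one, hMP, sub_self,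
      zero_mulVec, mulVec_zero]
  have hD : Dᴴ = D := by
    simp only [D, diagonal_conjTranspose]
    congr 1
    ext p
    simp only [Pi.star_apply]
    split_ifs <;> simp
  have h1 : P * D = P * D * P := by rwa [mul_sub, mul_one, sub_eq_zero] at hPD
  have h2 : D * P = P * D * P := by
    have := congrArg Matrix.conjTranspose h1
    rwa [conjTranspose_mul, conjTranspose_mul, conjTranspose_mul, hPh, hD, ← mul_assoc] at this
  have h3 := congrFun (congrFun (h2.trans h1.symm) (a, b)) (a', b')
  simpa [D, Matrix.mul_diagonal, Matrix.diagonal_mul, h.symm] using h3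

/-- The diagonal block of the Choi projection at an input symbol; for a cq-graph this is the
projection onto the support of the corresponding output state. -/
noncomputable def choiBlock (K : Submodule ℂ (Matrix B A ℂ)) (a : A) : Matrix B B ℂ :=
  (choiProjection K).submatrix (Prod.mk a) (Prod.mk a)

theorem choiBlock_isHermitian (a : A) : (choiBlock K a).IsHermitian :=
  (choiProjection_isHermitian K).submatrix _

variable {K}

theorem IsCQGraph.choiProjection_mulVec_apply (hK : IsCQGraph K) (v : A × B → ℂ) (a : A) (b : B) :
    (choiProjection K *ᵥ v) (a, b) = (choiBlock K a *ᵥ fun b => v (a, b)) b := by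
  simp only [mulVec, dotProduct, Fintype.sum_prod_type, choiBlock, submatrix_apply]
  refine Finset.sum_eq_single a (fun x _ hx => ?_) (by simp)
  exact Finset.sum_eq_zero fun y _ => by rw [hK.choiProjection_apply_of_ne hx.symm, zero_mul]

theorem IsCQGraph.choiProjection_mul_apply (hK : IsCQGraph K) (M : Matrix (A × B) (A × B) ℂ)
    (a a' : A) (b b' : B) :
    (choiProjection K * M) (a, b) (a', b')
      = (choiBlock K a * M.submatrix (Prod.mk a) (Prod.mk a')) b b' :=
  hK.choiProjection_mulVec_apply (fun p => M p (a', b')) a b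

theorem IsCQGraph.choiBlock_mul_self (hK : IsCQGraph K) (a : A) :
    choiBlock K a * choiBlock K a = choiBlock K a := by
  ext b b'
  have h := hK.choiProjection_mul_apply (choiProjection K) a a b b'
  rw [choiProjection_mul_self] at h
  exact h.symm

theorem IsCQGraph.choiBlock_mulVec_of_mem (hK : IsCQGraph K) {X : Matrix B A ℂ} (hX : X ∈ K)
    (a : A) : (choiBlock K a *ᵥ fun b => X b a) = fun b => X b a := by
  ext b
  rw [← hK.choiProjection_mulVec_apply (fun p => X p.2 p.1), choiProjection_mulVec_of_mem K hX]

/-- A zero block would annihilate column `a` of every Kraus operator and force `σ a = 0`, against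
trace one. -/
theorem IsCQGraph.choiBlock_ne_zero (hK : IsCQGraph K) (a : A) : choiBlock K a ≠ 0 := by
  intro h0
  have hz : ∀ X ∈ K, ∀ b, X b a = 0 := by
    intro X hX b
    have h := congrFun (hK.choiBlock_mulVec_of_mem hX a) b
    rw [h0, zero_mulVec] at h
    exact h.symm
  obtain ⟨σ, hσ, n, E, hE, rfl⟩ := hK
  have h1 : σ a = 0 := by
    ext b b'
    have h := congrFun (congrFun (hE (Matrix.single a a 1)) b) b'
    have h2 : (∑ x, Matrix.single a a (1 : ℂ) x x • σ x) = σ a := by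
      simp [Matrix.single_apply]
    rw [h2] at h
    rw [← h, Matrix.sum_apply]
    refine Finset.sum_eq_zero fun k _ => ?_
    have := hz (E k) (Submodule.subset_span ⟨k, rfl⟩) b
    simp [Matrix.mul_apply, Matrix.single_apply, ite_and, this]
  have := (hσ a).2
  simp [h1] at this

theorem mem_graphSpace_iff {V : Type*} [Fintype V] [DecidableEq V] {G : SimpleGraph V}
    {Z : Matrix V V ℂ} :
    Z ∈ graphSpace G ↔ ∀ i j, i ≠ j → ¬ G.Adj i j → Z i j = 0 := by
  constructor
  · intro hZ i j hij hG
    induction hZ using Submodule.span_induction with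
    | mem x hx =>
      obtain ⟨i', j', h, rfl⟩ := hx
      rw [Matrix.single_apply, if_neg]
      rintro ⟨rfl, rfl⟩
      exact h.elim hij hG
    | zero => rfl
    | add x y _ _ hx hy => simp [hx, hy]
    | smul c x _ hx => simp [hx]
  · intro h
    rw [Matrix.matrix_eq_sum_single Z]
    refine Submodule.sum_mem _ fun i _ => Submodule.sum_mem _ fun j _ => ?_
    by_cases hij : i = j ∨ G.Adj i j
    · rw [← mul_one (Z i j), ← smul_eq_mul, ← Matrix.smul_single]
      exact Submodule.smul_mem _ _ (Submodule.subset_span ⟨i, j, hij, rfl⟩)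
    · push Not at hij
      rw [h i j hij.1 hij.2, Matrix.single_zero]
      exact Submodule.zero_mem _

/-- Columns of the Choi projection are Choi vectors of elements of `K`. For two such elements `X`,
`Y`, the `(a, a')` entry of `X†Y` is an entry of the product of blocks. -/
theorem choiBlock_mul_choiBlock {G : SimpleGraph A}
    (hG : adjointProduct K ≤ graphSpace G) {a a' : A} (hne : a ≠ a') (hadj : ¬ G.Adj a a') :
    choiBlock K a * choiBlock K a' = 0 := by
  have key : ∀ a b, (Matrix.of fun b' a' => choiProjection K (a', b') (a, b)) ∈ K := by
    intro a b
    have h := choiProjection_mulVec_mem K (Pi.single (a, b) 1)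
    simpa using h
  ext b b'
  have h := mem_graphSpace_iff.1 (hG (Submodule.subset_span ⟨_, key a b, _, key a' b', rfl⟩))
    a a' hne hadj
  rw [← (choiBlock_isHermitian K a).eq]
  exact h

end Choi

/-! ### Both semidefinite programs in terms of the blocks -/

section Packing

variable {A B : Type*} [Fintype A] [DecidableEq A] [Fintype B] [DecidableEq B]

/-- Weights `s ≥ 0` form a fractional packing of the matrices `P` if `∑ₐ sₐ Pₐ ≤ 1`. -/
def IsPacking (P : A → Matrix B B ℂ) (s : A → ℝ) : Prop :=
  (∀ a, 0 ≤ s a) ∧ (1 - ∑ a, (s a : ℂ) • P a).PosSemidef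

theorem posSemidef_of_projection {n : Type*} [Fintype n] {P : Matrix n n ℂ}
    (h : P.IsHermitian) (hP : P * P = P) :
    P.PosSemidef := by
  rw [← hP]
  nth_rw 1 [← h.eq]
  exact posSemidef_conjTranspose_mul_self P

theorem one_sub_projection {P : Matrix B B ℂ} (h : P.IsHermitian) (hP : P * P = P) :
    (1 - P).IsHermitian ∧ (1 - P) * (1 - P) = 1 - P := by
  refine ⟨isHermitian_one.sub h, ?_⟩
  rw [mul_sub, sub_mul, sub_mul, hP]
  simp

theorem isPacking_single {P : A → Matrix B B ℂ} {a : A} (h : (P a).IsHermitian)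
    (hP : P a * P a = P a) : IsPacking P (Pi.single a 1) := by
  refine ⟨fun b => ?_, ?_⟩
  · by_cases hb : b = a
    · subst hb; simp
    · simp [hb]
  · have : ∑ b, ((Pi.single a (1 : ℝ) : A → ℝ) b : ℂ) • P b = P a := by
      rw [Finset.sum_eq_single a]
      · simp
      · intro b _ hb; simp [hb]
      · simp
    rw [this]
    obtain ⟨h1, h2⟩ := one_sub_projection h hP
    exact posSemidef_of_projection h1 h2

/-- Dropping the other terms leaves `s a • P a ≤ 1`; compressing by `P a` gives `(1 - s a) • P a ≥
0`, whose trace decides the sign. -/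
theorem IsPacking.le_one {P : A → Matrix B B ℂ} {s : A → ℝ} (hs : IsPacking P s)
    (h : ∀ a, (P a).IsHermitian) (hP : ∀ a, P a * P a = P a) {a : A} (h0 : P a ≠ 0) :
    s a ≤ 1 := by
  have h1 : (1 - (s a : ℂ) • P a).PosSemidef := by
    have e : 1 - (s a : ℂ) • P a
        = (1 - ∑ b, (s b : ℂ) • P b) + ∑ b ∈ Finset.univ.erase a, (s b : ℂ) • P b := by
      rw [← Finset.add_sum_erase _ _ (Finset.mem_univ a)]
      abel
    rw [e]
    refine hs.2.add (posSemidef_sum _ fun b _ => ?_)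
    exact (posSemidef_of_projection (h b) (hP b)).smul (by exact_mod_cast hs.1 b)
  have h2 := (h1.conjTranspose_mul_mul_same (P a)).trace_nonneg
  have e : (P a)ᴴ * (1 - (s a : ℂ) • P a) * P a = ((1 - s a : ℝ) : ℂ) • P a := by
    rw [(h a).eq, mul_sub, mul_one, mul_smul_comm, hP, sub_mul, smul_mul_assoc, hP]
    push_cast
    rw [sub_smul, one_smul]
  rw [e, trace_smul, smul_eq_mul] at h2
  have h3 : 0 < (P a).trace := by
    refine lt_of_le_of_ne (posSemidef_of_projection (h a) (hP a)).trace_nonneg fun ht => h0 ?_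
    exact (posSemidef_of_projection (h a) (hP a)).trace_eq_zero_iff.1 ht.symm
  have h4 : (0 : ℂ) ≤ ((1 - s a : ℝ) : ℂ) := le_of_mul_le_mul_right (by simpa using h2) h3
  have h5 : 0 ≤ 1 - s a := by exact_mod_cast h4
  linarith

variable {K : Submodule ℂ (Matrix B A ℂ)}

theorem IsCQGraph.traceA_choiProjection_mul (hK : IsCQGraph K) (S : Matrix A A ℂ) :
    traceA (choiProjection K * (S ⊗ₖ (1 : Matrix B B ℂ))) = ∑ a, S a a • choiBlock K a := by
  ext b b'
  simp only [traceA, of_apply, hK.choiProjection_mul_apply, Matrix.sum_apply]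
  refine Finset.sum_congr rfl fun a _ => ?_
  have : (S ⊗ₖ (1 : Matrix B B ℂ)).submatrix (Prod.mk a) (Prod.mk a) = S a a • 1 := by
    ext; simp
  rw [this]
  simp

theorem IsCQGraph.trace_choiProjection_mul (hK : IsCQGraph K) (M : Matrix (A × B) (A × B) ℂ) :
    (choiProjection K * M).trace
      = ∑ a, (choiBlock K a * M.submatrix (Prod.mk a) (Prod.mk a)).trace := by
  simp only [trace, diag_apply, Fintype.sum_prod_type, hK.choiProjection_mul_apply]

/-- This bounds the sets whose `sSup` defines the two numbers, so neither falls back to the default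
value. -/
theorem IsCQGraph.isPacking_le (hK : IsCQGraph K) {s : A → ℝ} (hs : IsPacking (choiBlock K) s) :
    ∑ a, s a ≤ Fintype.card A := by
  refine (Finset.sum_le_sum fun a _ => hs.le_one (choiBlock_isHermitian K) hK.choiBlock_mul_self
    (hK.choiBlock_ne_zero a)).trans ?_
  simp

theorem _root_.Matrix.PosSemidef.ofReal_re_diag {n : Type*} {S : Matrix n n ℂ} (hS : S.PosSemidef)
    (a : n) :
    ((S a a).re : ℂ) = S a a :=
  (Complex.eq_re_of_ofReal_le (r := 0) (by simpa using hS.diag_nonneg)).symm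

theorem IsCQGraph.packing_set_eq (hK : IsCQGraph K) :
    {x | ∃ S : Matrix A A ℂ, S.PosSemidef ∧
      (1 - traceA (choiProjection K * (S ⊗ₖ (1 : Matrix B B ℂ)))).PosSemidef ∧ x = S.trace.re}
    = {x | ∃ s, IsPacking (choiBlock K) s ∧ x = ∑ a, s a} := by
  ext x
  constructor
  · rintro ⟨S, hS, h, rfl⟩
    refine ⟨fun a => (S a a).re, ⟨fun a => ?_, ?_⟩, by simp [trace]⟩
    · exact (Complex.nonneg_iff.1 hS.diag_nonneg).1
    · simpa only [hS.ofReal_re_diag, hK.traceA_choiProjection_mul] using h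
  · rintro ⟨s, hs, rfl⟩
    refine ⟨Matrix.diagonal fun a => (s a : ℂ), ?_, ?_, by simp [trace]⟩
    · exact posSemidef_diagonal_iff.2 fun a => by exact_mod_cast hs.1 a
    · simpa [hK.traceA_choiProjection_mul] using hs.2

theorem IsCQGraph.le_packingNumber (hK : IsCQGraph K) {s : A → ℝ}
    (hs : IsPacking (choiBlock K) s) : ∑ a, s a ≤ packingNumber K := by
  unfold packingNumber
  rw [hK.packing_set_eq]
  refine le_csSup ⟨Fintype.card A, ?_⟩ ⟨s, hs, rfl⟩
  rintro _ ⟨s, hs, rfl⟩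
  exact hK.isPacking_le hs

theorem IsCQGraph.packingNumber_le (hK : IsCQGraph K) {t : ℝ} (ht : 0 ≤ t)
    (h : ∀ s, IsPacking (choiBlock K) s → ∑ a, s a ≤ t) : packingNumber K ≤ t := by
  unfold packingNumber
  rw [hK.packing_set_eq]
  refine Real.sSup_le ?_ ht
  rintro _ ⟨s, hs, rfl⟩
  exact h s hs

theorem IsCQGraph.one_le_packingNumber [Nonempty A] (hK : IsCQGraph K) : 1 ≤ packingNumber K := by
  obtain ⟨a⟩ := ‹Nonempty A›
  have := hK.le_packingNumber
    (isPacking_single (choiBlock_isHermitian K a) (hK.choiBlock_mul_self a))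
  simpa using this

/-- With `M = X†X`, the trace is the squared Hilbert–Schmidt norm of `X * P`. -/
theorem mul_eq_zero_of_trace_eq_zero {P M : Matrix B B ℂ} (h : P.IsHermitian) (hP : P * P = P)
    (hM : M.PosSemidef) (h0 : (P * M).trace = 0) : P * M = 0 := by
  have h1 : (Pᴴ * M * P).trace = 0 := by
    rw [h.eq, trace_mul_comm, ← mul_assoc, hP, h0]
  have h2 := (hM.conjTranspose_mul_mul_same P).trace_eq_zero_iff.1 h1
  obtain ⟨X, rfl⟩ : ∃ X : Matrix B B ℂ, M = Xᴴ * X := by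
    open scoped MatrixOrder in
    obtain ⟨X, hX⟩ := CStarAlgebra.nonneg_iff_eq_star_mul_self.1 hM.nonneg
    exact ⟨X, hX⟩
  have h3 : (X * P)ᴴ * (X * P) = 0 := by
    rw [conjTranspose_mul, ← h2]
    simp only [mul_assoc]
  have h4 : X * P = 0 := conjTranspose_mul_self_eq_zero.1 h3
  have h5 : P * Xᴴ = 0 := by
    have := congrArg conjTranspose h4
    rwa [conjTranspose_mul, h.eq, conjTranspose_zero] at this
  rw [← mul_assoc, h5, zero_mul]

/-- The trace condition splits into non-negative terms, which gives `P a * N a = s a • P a` for the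
diagonal blocks `N a` of `U`. Hence `N a - s a • P a` is the compression of `N a` by `1 - P a`, and
these sum to `1 - ∑ s a • P a`. -/
theorem UpsilonFeasible.isPacking (hK : IsCQGraph K) {S : Matrix A A ℂ}
    {U : Matrix (A × B) (A × B) ℂ} (h : UpsilonFeasible K S U) :
    IsPacking (choiBlock K) fun a => (S a a).re := by
  obtain ⟨hU, hSU, hT, h0⟩ := h
  let N : A → Matrix B B ℂ := fun a => U.submatrix (Prod.mk a) (Prod.mk a)
  have hN : ∀ a, (N a).PosSemidef := fun a => hU.submatrix _
  have e : ∀ a, (S ⊗ₖ (1 : Matrix B B ℂ) - U).submatrix (Prod.mk a) (Prod.mk a)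
      = S a a • 1 - N a := by
    intro a; ext b b'; simp [N]
  have hSN : ∀ a, (S a a • 1 - N a).PosSemidef := fun a => e a ▸ hSU.submatrix _
  have hPh := choiBlock_isHermitian K
  have hPP := hK.choiBlock_mul_self
  have hnn : ∀ a, 0 ≤ (choiBlock K a * (S a a • 1 - N a)).trace := by
    intro a
    have := ((hSN a).conjTranspose_mul_mul_same (choiBlock K a)).trace_nonneg
    rwa [(hPh a).eq, trace_mul_comm, ← mul_assoc, hPP] at this
  rw [hK.trace_choiProjection_mul] at h0
  simp only [e] at h0
  have hz : ∀ a, choiBlock K a * (S a a • 1 - N a) = 0 := fun a =>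
    mul_eq_zero_of_trace_eq_zero (hPh a) (hPP a) (hSN a)
      ((Finset.sum_eq_zero_iff_of_nonneg fun a _ => hnn a).1 h0 a (Finset.mem_univ a))
  have hz' : ∀ a, (S a a • 1 - N a) * choiBlock K a = 0 := by
    intro a
    have := congrArg conjTranspose (hz a)
    rwa [conjTranspose_mul, (hPh a).eq, (hSN a).1.eq, conjTranspose_zero] at this
  have h1 : ∀ a, N a - S a a • choiBlock K a
      = (1 - choiBlock K a)ᴴ * N a * (1 - choiBlock K a) := by
    intro a
    have e1 : choiBlock K a * N a = S a a • choiBlock K a := by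
      have := hz a
      rw [mul_sub, mul_smul_comm, mul_one, sub_eq_zero] at this
      exact this.symm
    have e2 : N a * choiBlock K a = S a a • choiBlock K a := by
      have := hz' a
      rw [sub_mul, smul_mul_assoc, one_mul, sub_eq_zero] at this
      exact this.symm
    rw [(isHermitian_one.sub (hPh a)).eq, sub_mul, one_mul, e1, mul_sub, mul_one, sub_mul, e2,
      smul_mul_assoc, hPP]
    simp
  -- The sign of `S a a` is read from a diagonal entry of `S a a • 1`, which needs a point of `B`;
  -- an empty `B` is excluded because the blocks are non-zero.
  have hd : ∀ a, 0 ≤ S a a ∨ IsEmpty B := by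
    intro a
    rcases isEmpty_or_nonempty B with hB | ⟨⟨b⟩⟩
    · exact Or.inr hB
    · left
      have := ((hSN a).add (hN a)).diag_nonneg (i := b)
      simpa using this
  have hd : ∀ a, 0 ≤ S a a := by
    intro a
    rcases hd a with h | h
    · exact h
    · exact absurd (Subsingleton.elim _ _) (hK.choiBlock_ne_zero a)
  refine ⟨fun a => (Complex.nonneg_iff.1 (hd a)).1, ?_⟩
  have hre : ∀ a, ((S a a).re : ℂ) = S a a := fun a =>
    (Complex.eq_re_of_ofReal_le (r := 0) (by simpa using hd a)).symm
  simp only [hre]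
  have hsum : (1 : Matrix B B ℂ) = ∑ a, N a := by
    rw [← hT]
    ext b b'
    simp [traceA, N, Matrix.sum_apply]
  rw [hsum, ← Finset.sum_sub_distrib]
  refine posSemidef_sum _ fun a _ => ?_
  rw [h1]
  exact (hN a).conjTranspose_mul_mul_same _

theorem IsCQGraph.upsilon_le_packingNumber [Nonempty A] (hK : IsCQGraph K) :
    upsilon K ≤ packingNumber K := by
  refine Real.sSup_le ?_ (zero_le_one.trans hK.one_le_packingNumber)
  rintro _ ⟨S, U, h, rfl⟩
  simpa [trace] using hK.le_packingNumber (h.isPacking hK)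

/-- The diagonal `S` with entries `s a` and the block diagonal `U` with blocks `N a` are feasible.
-/
theorem IsCQGraph.le_upsilon (hK : IsCQGraph K) {s : A → ℝ} {N : A → Matrix B B ℂ}
    (hN : ∀ a, (N a).PosSemidef) (hsN : ∀ a, ((s a : ℂ) • 1 - N a).PosSemidef)
    (hsum : ∑ a, N a = 1) (h0 : ∀ a, choiBlock K a * ((s a : ℂ) • 1 - N a) = 0) :
    ∑ a, s a ≤ upsilon K := by
  have hsub : ∀ (M : A → Matrix B B ℂ) (x x' : A) (b b' : B),
      (∑ a, Matrix.single a a (1 : ℂ) ⊗ₖ M a) (x, b) (x', b')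
        = if x = x' then M x b b' else 0 := by
    intro M x x' b b'
    simp only [Matrix.sum_apply, kroneckerMap_apply]
    rw [Finset.sum_eq_single x]
    · simp [Matrix.single_apply]
    · intro a _ ha; simp [ha]
    · simp
  have hpsd : ∀ M : A → Matrix B B ℂ, (∀ a, (M a).PosSemidef) →
      (∑ a, Matrix.single a a (1 : ℂ) ⊗ₖ M a).PosSemidef := by
    intro M hM
    refine posSemidef_sum _ fun a _ => PosSemidef.kronecker ?_ (hM a)
    rw [← Matrix.diagonal_single]
    refine posSemidef_diagonal_iff.2 fun i => ?_
    by_cases h : i = a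
    · subst h; simp
    · simp [h]
  have e : (Matrix.diagonal fun a => (s a : ℂ)) ⊗ₖ (1 : Matrix B B ℂ)
      - ∑ a, Matrix.single a a (1 : ℂ) ⊗ₖ N a
      = ∑ a, Matrix.single a a (1 : ℂ) ⊗ₖ ((s a : ℂ) • 1 - N a) := by
    ext ⟨x, b⟩ ⟨x', b'⟩
    rw [Matrix.sub_apply, hsub, hsub]
    by_cases h : x = x'
    · subst h; simp
    · simp [h]
  refine le_csSup ⟨Fintype.card A, ?_⟩
    ⟨Matrix.diagonal fun a => (s a : ℂ), ∑ a, Matrix.single a a (1 : ℂ) ⊗ₖ N a,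
      ⟨hpsd N hN, ?_, ?_, ?_⟩, ?_⟩
  · rintro _ ⟨S, U, h, rfl⟩
    simpa [trace] using hK.isPacking_le (h.isPacking hK)
  · rw [e]; exact hpsd _ hsN
  · rw [← hsum]
    ext b b'
    simp only [traceA, of_apply, hsub, if_true, Matrix.sum_apply]
  · rw [e, hK.trace_choiProjection_mul]
    refine Finset.sum_eq_zero fun a _ => ?_
    have : (∑ a, Matrix.single a a (1 : ℂ) ⊗ₖ ((s a : ℂ) • 1 - N a)).submatrix
        (Prod.mk a) (Prod.mk a) = (s a : ℂ) • 1 - N a := by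
      ext b b'
      rw [submatrix_apply, hsub, if_pos rfl]
    rw [this, h0, trace_zero]
  · simp [trace]

end Packing

/-! ### Completing two orthogonal packings to a resolution of the identity -/

section Sum

variable {V W B : Type*} [Fintype V] [DecidableEq V] [Fintype W] [DecidableEq W] [Fintype B]
  [DecidableEq B]

/-- The summand of a resolution of the identity that completes `s • p` by the part `1 - Q - X` of
the identity, which is orthogonal to `p`. -/
theorem completion_properties {Q p X : Matrix B B ℂ} (hQ : Q.IsHermitian) (hQQ : Q * Q = Q)
    (hp : p.IsHermitian) (hpp : p * p = p) (hQp : Q * p = p) (hX : X.PosSemidef)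
    (hX1 : (1 - X).PosSemidef) (hQX : Q * X = 0) {s r : ℝ} (hs : 0 ≤ s) (hr : 1 ≤ r) :
    ((s : ℂ) • p + ((s / r : ℝ) : ℂ) • (1 - Q - X)).PosSemidef ∧
    ((s : ℂ) • 1 - ((s : ℂ) • p + ((s / r : ℝ) : ℂ) • (1 - Q - X))).PosSemidef ∧
    p * ((s : ℂ) • 1 - ((s : ℂ) • p + ((s / r : ℝ) : ℂ) • (1 - Q - X))) = 0 := by
  have hXQ : X * Q = 0 := by
    have := congrArg conjTranspose hQX
    rwa [conjTranspose_mul, hQ.eq, hX.1.eq, conjTranspose_zero] at this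
  have hpQ : p * Q = p := by
    have := congrArg conjTranspose hQp
    rwa [conjTranspose_mul, hQ.eq, hp.eq] at this
  have hpX : p * X = 0 := by rw [← hpQ, mul_assoc, hQX, mul_zero]
  have hr0 : 0 < r := by linarith
  -- This is the compression of `1 - X` by `1 - Q`.
  have hD : (1 - Q - X).PosSemidef := by
    have := hX1.conjTranspose_mul_mul_same (1 - Q)
    rw [(isHermitian_one.sub hQ).eq] at this
    convert this using 1
    simp only [mul_sub, sub_mul, mul_one, one_mul, hQQ, hXQ, hQX]
    simp
  have h1p : (1 - p).PosSemidef := by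
    obtain ⟨h1, h2⟩ := one_sub_projection hp hpp
    exact posSemidef_of_projection h1 h2
  -- This is `(Q - p) + X`, where `Q - p` is the compression of `1 - p` by `Q`.
  have hE : (1 - p - (1 - Q - X)).PosSemidef := by
    have := (h1p.conjTranspose_mul_mul_same Q).add hX
    rw [hQ.eq] at this
    convert this using 1
    simp only [mul_sub, sub_mul, mul_one, hQQ, hQp, hpQ]
    abel
  have hsr : 0 ≤ s / r := div_nonneg hs hr0.le
  refine ⟨?_, ?_, ?_⟩
  · exact ((posSemidef_of_projection hp hpp).smul (by exact_mod_cast hs)).add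
      (hD.smul (by exact_mod_cast hsr))
  · have e : (s : ℂ) • 1 - ((s : ℂ) • p + ((s / r : ℝ) : ℂ) • (1 - Q - X))
        = ((s - s / r : ℝ) : ℂ) • (1 - p) + ((s / r : ℝ) : ℂ) • (1 - p - (1 - Q - X)) := by
      push_cast
      module
    rw [e]
    refine (h1p.smul ?_).add (hE.smul (by exact_mod_cast hsr))
    have : 0 ≤ s - s / r := sub_nonneg.2 (div_le_self hs hr)
    exact_mod_cast this
  · simp only [mul_sub, mul_add, mul_smul_comm, mul_one, hpp, hpQ, hpX]
    simp

theorem sum_div_sum_smul {ι : Type*} [Fintype ι] (f : ι → ℝ) {E : Type*} [AddCommGroup E]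
    [Module ℂ E] (D : E) (hf : 1 ≤ ∑ i, f i) : ∑ i, ((f i / ∑ j, f j : ℝ) : ℂ) • D = D := by
  rw [← Finset.sum_smul, ← Complex.ofReal_sum, ← Finset.sum_div, div_self (by linarith)]
  simp

/-- The gap `Q - Y` left by the second packing is distributed over `V` in proportion to `s`, and the
gap `1 - Q - X` left by the first over `W` in proportion to `t`. Total weights of at least 1 keep
each share below the bound `s v` or `t w`. -/
theorem IsCQGraph.add_le_upsilon {K : Submodule ℂ (Matrix B (V ⊕ W) ℂ)} (hK : IsCQGraph K)
    (horth : ∀ v w, choiBlock K (.inl v) * choiBlock K (.inr w) = 0)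
    {s : V → ℝ} {t : W → ℝ} (hs : IsPacking (fun v => choiBlock K (.inl v)) s)
    (ht : IsPacking (fun w => choiBlock K (.inr w)) t) (hs1 : 1 ≤ ∑ v, s v) (ht1 : 1 ≤ ∑ w, t w) :
    ∑ v, s v + ∑ w, t w ≤ upsilon K := by
  have hPh := choiBlock_isHermitian K
  have hPP := hK.choiBlock_mul_self
  obtain ⟨Q, hQ, hQQ, hQP, hRQ⟩ := exists_projection_separating
    (P := fun w => choiBlock K (.inr w)) (R := fun v => choiBlock K (.inl v)) horth
  have hQR : ∀ v, Q * choiBlock K (.inl v) = 0 := by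
    intro v
    have := congrArg conjTranspose (hRQ v)
    rwa [conjTranspose_mul, hQ.eq, (hPh _).eq, conjTranspose_zero] at this
  obtain ⟨hQ', hQQ'⟩ := one_sub_projection hQ hQQ
  set X := ∑ v, (s v : ℂ) • choiBlock K (.inl v) with hXdef
  set Y := ∑ w, (t w : ℂ) • choiBlock K (.inr w) with hYdef
  have hX : X.PosSemidef := posSemidef_sum _ fun v _ =>
    (posSemidef_of_projection (hPh _) (hPP _)).smul (by exact_mod_cast hs.1 v)
  have hY : Y.PosSemidef := posSemidef_sum _ fun v _ =>
    (posSemidef_of_projection (hPh _) (hPP _)).smul (by exact_mod_cast ht.1 v)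
  have hQX : Q * X = 0 := by
    rw [hXdef, Matrix.mul_sum]
    exact Finset.sum_eq_zero fun v _ => by rw [mul_smul_comm, hQR, smul_zero]
  have hQY : (1 - Q) * Y = 0 := by
    rw [hYdef, Matrix.mul_sum]
    exact Finset.sum_eq_zero fun v _ => by
      rw [mul_smul_comm, sub_mul, one_mul, hQP, sub_self, smul_zero]
  have hl := fun v => completion_properties hQ' hQQ' (hPh (.inl v)) (hPP (.inl v))
    (by rw [sub_mul, one_mul, hQR, sub_zero]) hY ht.2 hQY (hs.1 v) hs1
  have hr := fun w => completion_properties hQ hQQ (hPh (.inr w)) (hPP (.inr w))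
    (hQP w) hX hs.2 hQX (ht.1 w) ht1
  have := hK.le_upsilon (s := Sum.elim s t)
    (N := Sum.elim
      (fun v => (s v : ℂ) • choiBlock K (.inl v)
        + ((s v / ∑ x, s x : ℝ) : ℂ) • (1 - (1 - Q) - Y))
      (fun w => (t w : ℂ) • choiBlock K (.inr w) + ((t w / ∑ x, t x : ℝ) : ℂ) • (1 - Q - X)))
    (by rintro (v | w); exacts [(hl v).1, (hr w).1])
    (by rintro (v | w); exacts [(hl v).2.1, (hr w).2.1])
    (by
      rw [Fintype.sum_sum_type]
      simp only [Sum.elim_inl, Sum.elim_inr, Finset.sum_add_distrib]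
      rw [sum_div_sum_smul s _ hs1, sum_div_sum_smul t _ ht1, ← hXdef, ← hYdef]
      abel)
    (by rintro (v | w); exacts [(hl v).2.2, (hr w).2.2])
  simpa using this

end Sum

/-! ### Duality between packings and states -/

section Minimax

theorem _root_.Matrix.PosSemidef.exists_eq_mul_conjTranspose {𝕜 n : Type*} [RCLike 𝕜] [Fintype n]
    [DecidableEq n] {M : Matrix n n 𝕜} (hM : M.PosSemidef) : ∃ X : Matrix n n 𝕜, M = X * Xᴴ := by
  open scoped MatrixOrder in
  obtain ⟨X, hX⟩ := CStarAlgebra.nonneg_iff_eq_star_mul_self.1 hM.nonneg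
  exact ⟨Xᴴ, by rw [conjTranspose_conjTranspose]; exact hX⟩

theorem re_trace_conj_nonneg {B : Type*} [Fintype B] {P : Matrix B B ℂ} (hP : P.PosSemidef)
    (X : Matrix B B ℂ) :
    0 ≤ (Xᴴ * P * X).trace.re :=
  (Complex.nonneg_iff.1 (hP.conjTranspose_mul_mul_same X).trace_nonneg).1

theorem trace_conj_eq {B : Type*} [Fintype B] (P X : Matrix B B ℂ) :
    (Xᴴ * P * X).trace = (P * (X * Xᴴ)).trace := by
  rw [mul_assoc, trace_mul_comm, mul_assoc]

/-- The set of vectors `(Tr Pₐ T)ₐ` over all density matrices `T = X X†`. -/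
def stateValues {A B : Type*} [Fintype B] (P : A → Matrix B B ℂ) : Set (A → ℝ) :=
  {y | ∃ X : Matrix B B ℂ, (Xᴴ * X).trace = 1 ∧ y = fun a => (Xᴴ * P a * X).trace.re}

/-- A mixture of `X X†` and `Y Y†` is positive semidefinite, hence again of the form `Z Z†`. -/
theorem convex_stateValues {A B : Type*} [Fintype B] [DecidableEq B] (P : A → Matrix B B ℂ) :
    Convex ℝ (stateValues P) := by
  rintro _ ⟨X, hX, rfl⟩ _ ⟨Y, hY, rfl⟩ p q hp hq hpq
  have hT : ((p : ℂ) • (X * Xᴴ) + (q : ℂ) • (Y * Yᴴ)).PosSemidef :=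
    ((posSemidef_self_mul_conjTranspose X).smul (by exact_mod_cast hp)).add
      ((posSemidef_self_mul_conjTranspose Y).smul (by exact_mod_cast hq))
  obtain ⟨Z, hZ⟩ := hT.exists_eq_mul_conjTranspose
  refine ⟨Z, ?_, ?_⟩
  · rw [trace_mul_comm, ← hZ, trace_add, trace_smul, trace_smul, trace_mul_comm X,
      trace_mul_comm Y, hX, hY]
    simp only [smul_eq_mul, mul_one]
    exact_mod_cast hpq
  · ext a
    simp only [trace_conj_eq, ← hZ, Pi.add_apply, Pi.smul_apply, mul_add, mul_smul_comm, trace_add,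
      trace_smul, smul_eq_mul, Complex.add_re, Complex.re_ofReal_mul]

/-- Parametrising states by their factors `X` makes this a continuous image of the Hilbert–Schmidt
unit sphere. -/
theorem isCompact_stateValues {A B : Type*} [Fintype B] (P : A → Matrix B B ℂ) :
    IsCompact (stateValues P) := by
  let m : EuclideanSpace ℂ (B × B) → Matrix B B ℂ := fun x => Matrix.of fun i j => x (i, j)
  have hm : Continuous m := by
    refine continuous_matrix fun i j => ?_
    simp only [m, of_apply]
    fun_prop
  have hf : Continuous fun x : EuclideanSpace ℂ (B × B) =>
      fun a => ((m x)ᴴ * P a * m x).trace.re := by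
    refine continuous_pi fun a => Complex.continuous_re.comp ?_
    exact ((hm.matrix_conjTranspose.matrix_mul continuous_const).matrix_mul hm).matrix_trace
  convert (isCompact_sphere (0 : EuclideanSpace ℂ (B × B)) 1).image hf using 1
  have hn : ∀ x : EuclideanSpace ℂ (B × B), ((m x)ᴴ * m x).trace = ((‖x‖ ^ 2 : ℝ) : ℂ) := by
    intro x
    rw [EuclideanSpace.norm_sq_eq, Fintype.sum_prod_type, Finset.sum_comm]
    push_cast
    simp only [trace, diag_apply, mul_apply, conjTranspose_apply, m, of_apply]
    refine Finset.sum_congr rfl fun i _ => Finset.sum_congr rfl fun j _ => ?_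
    exact Complex.conj_mul' _
  ext y
  constructor
  · rintro ⟨X, hX, rfl⟩
    refine ⟨WithLp.toLp 2 fun p => X p.1 p.2, ?_, rfl⟩
    have h := hn (WithLp.toLp 2 fun p => X p.1 p.2)
    have e : m (WithLp.toLp 2 fun p => X p.1 p.2) = X := rfl
    rw [e, hX] at h
    have h' : ‖(WithLp.toLp 2 fun p => X p.1 p.2 : EuclideanSpace ℂ (B × B))‖ ^ 2 = 1 := by
      exact_mod_cast h.symm
    rw [mem_sphere_zero_iff_norm]
    exact (pow_eq_one_iff_of_nonneg (norm_nonneg _) two_ne_zero).1 h'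
  · rintro ⟨x, hx, rfl⟩
    refine ⟨m x, ?_, rfl⟩
    rw [hn, mem_sphere_zero_iff_norm.1 hx]
    simp

/-- Semidefinite duality for fractional packings. -/
theorem exists_state_or_exists_packing {A B : Type*} [Fintype A] [DecidableEq A] [Fintype B]
    [DecidableEq B] [Nonempty B] {P : A → Matrix B B ℂ}
    (hP : ∀ a, (P a).PosSemidef) {α : ℝ} (hα : 0 < α) :
    (∃ X : Matrix B B ℂ, (Xᴴ * X).trace = 1 ∧ ∀ a, 1 / α ≤ (Xᴴ * P a * X).trace.re) ∨
    ∃ s, IsPacking P s ∧ α < ∑ a, s a := by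
  by_cases hdis : Disjoint (stateValues P) (Set.Ici fun _ => 1 / α)
  swap
  · obtain ⟨_, ⟨X, hX, rfl⟩, h⟩ := Set.not_disjoint_iff.1 hdis
    exact Or.inl ⟨X, hX, h⟩
  right
  obtain ⟨f, β, γ, h1, h2, h3⟩ := geometric_hahn_banach_compact_closed (convex_stateValues P)
    (isCompact_stateValues P) (convex_Ici _) isClosed_Ici hdis
  let w : A → ℝ := fun a => f (Pi.single a 1)
  have hf : ∀ y, f y = ∑ a, w a * y a := by
    intro y
    conv_lhs => rw [← Finset.univ_sum_single y]
    rw [map_sum]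
    refine Finset.sum_congr rfl fun a _ => ?_
    have : (Pi.single a (y a) : A → ℝ) = y a • Pi.single a 1 := by
      rw [← Pi.single_smul, smul_eq_mul, mul_one]
    rw [this, map_smul, smul_eq_mul, mul_comm]
  -- The functional is bounded below on the orthant, which is unbounded in each positive coordinate
  -- direction.
  have hw : ∀ a, 0 ≤ w a := by
    intro a
    by_contra! hneg
    set y₀ : A → ℝ := fun _ => 1 / α
    have hy : ∀ r : ℝ, 0 ≤ r → γ < f y₀ + r * w a := by
      intro r hr
      have := h3 (y₀ + r • Pi.single a 1) (by
        intro b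
        have : 0 ≤ (Pi.single a (1 : ℝ) : A → ℝ) b := by
          by_cases hb : b = a
          · subst hb; simp
          · simp [hb]
        simpa [y₀] using mul_nonneg hr this)
      simpa [w] using this
    have h0 := hy 0 le_rfl
    have := hy ((f y₀ - γ) / (-w a)) (div_nonneg (by linarith) (by linarith))
    rw [div_mul_eq_mul_div, div_neg, mul_div_cancel_right₀ _ hneg.ne] at this
    linarith
  have hX : ∀ X : Matrix B B ℂ, (Xᴴ * X).trace = 1 →
      ∑ a, w a * (Xᴴ * P a * X).trace.re < β := by
    intro X hX
    have := h1 _ ⟨X, hX, rfl⟩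
    rwa [hf] at this
  obtain ⟨b₀⟩ := ‹Nonempty B›
  -- Rank-one factors realise the pure state of `v`, so the bound over all states also bounds the
  -- quadratic form.
  have hrank : ∀ (v : B → ℂ) (M : Matrix B B ℂ),
      ((vecMulVec v (Pi.single b₀ 1))ᴴ * M * vecMulVec v (Pi.single b₀ 1)).trace
        = star v ⬝ᵥ (M *ᵥ v) := by
    intro v M
    rw [conjTranspose_vecMulVec, mul_assoc, mul_vecMulVec, vecMulVec_mul_vecMulVec,
      trace_vecMulVec]
    simp
  have hβ : 0 < β := by
    refine lt_of_le_of_lt ?_ (hX (vecMulVec (Pi.single b₀ 1) (Pi.single b₀ 1)) ?_)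
    · exact Finset.sum_nonneg fun a _ => mul_nonneg (hw a) (re_trace_conj_nonneg (hP a) _)
    · have := hrank (Pi.single b₀ 1) 1
      rw [mul_one, one_mulVec] at this
      rw [this]
      simp
  have hM : ((β : ℂ) • 1 - ∑ a, (w a : ℂ) • P a).PosSemidef := by
    refine PosSemidef.of_dotProduct_mulVec_nonneg ?_ fun v => ?_
    · refine ((isHermitian_one).smul (Complex.conj_ofReal β)).sub ?_
      exact (posSemidef_sum _ fun a _ => (hP a).smul (by exact_mod_cast hw a)).1
    let q : A → ℝ := fun a => (star v ⬝ᵥ (P a *ᵥ v)).re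
    have hq : ∀ a, star v ⬝ᵥ (P a *ᵥ v) = (q a : ℂ) := fun a =>
      Complex.eq_re_of_ofReal_le (r := 0) (by simpa using (hP a).dotProduct_mulVec_nonneg v)
    let r : ℝ := (star v ⬝ᵥ v).re
    have hr : star v ⬝ᵥ v = (r : ℂ) :=
      Complex.eq_re_of_ofReal_le (r := 0) (by simp)
    have e : star v ⬝ᵥ (((β : ℂ) • 1 - ∑ a, (w a : ℂ) • P a) *ᵥ v)
        = ((β * r - ∑ a, w a * q a : ℝ) : ℂ) := by
      simp only [sub_mulVec, dotProduct_sub, smul_mulVec, one_mulVec, dotProduct_smul,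
        Matrix.sum_mulVec, dotProduct_sum, hq, hr, smul_eq_mul]
      push_cast
      rfl
    rw [e]
    rcases eq_or_ne v 0 with rfl | hv
    · simp [q, r]
    have hr0 : 0 < r := by
      have h0 : (0 : ℂ) ≤ r := hr ▸ dotProduct_star_self_nonneg v
      refine lt_of_le_of_ne (by exact_mod_cast h0) fun h => hv ?_
      rw [← dotProduct_star_self_eq_zero, hr, ← h, Complex.ofReal_zero]
    have hscale : ∀ (M : Matrix B B ℂ) (m : ℝ), star v ⬝ᵥ (M *ᵥ v) = (m : ℂ) →
        star ((((√r)⁻¹ : ℝ) : ℂ) • v) ⬝ᵥ (M *ᵥ ((((√r)⁻¹ : ℝ) : ℂ) • v)) = ((m / r : ℝ) : ℂ) := by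
      intro M m hm
      rw [star_smul, smul_dotProduct, mulVec_smul, dotProduct_smul, hm, Complex.star_def,
        Complex.conj_ofReal, smul_eq_mul, smul_eq_mul, ← Complex.ofReal_mul, ← Complex.ofReal_mul,
        ← mul_assoc, ← mul_inv, Real.mul_self_sqrt hr0.le, div_eq_inv_mul]
    have hlt := hX (vecMulVec ((((√r)⁻¹ : ℝ) : ℂ) • v) (Pi.single b₀ 1)) (by
      have h := hrank ((((√r)⁻¹ : ℝ) : ℂ) • v) 1
      rw [hscale 1 r (by rw [one_mulVec, hr]), mul_one] at h
      rw [h, div_self hr0.ne', Complex.ofReal_one])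
    simp only [hrank, hscale _ _ (hq _), Complex.ofReal_re, ← mul_div_assoc] at hlt
    rw [← Finset.sum_div, div_lt_iff₀ hr0] at hlt
    exact_mod_cast (sub_pos.2 hlt).le
  -- At the corner of the orthant, `(∑ w a) / α > γ > β`, so the rescaled weights sum to more than
  -- `α`.
  refine ⟨fun a => w a / β, ⟨fun a => div_nonneg (hw a) hβ.le, ?_⟩, ?_⟩
  · have := hM.smul (show (0 : ℂ) ≤ ((β⁻¹ : ℝ) : ℂ) by exact_mod_cast (inv_pos.2 hβ).le)
    convert this using 1
    rw [smul_sub, smul_smul, Finset.smul_sum, ← Complex.ofReal_mul, inv_mul_cancel₀ hβ.ne']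
    simp only [smul_smul, ← Complex.ofReal_mul, div_eq_inv_mul]
    simp
  · have := h3 _ (le_refl (fun _ => 1 / α))
    rw [hf, ← Finset.sum_mul, mul_one_div, lt_div_iff₀ hα] at this
    rw [← Finset.sum_div, lt_div_iff₀ hβ]
    nlinarith

end Minimax

/-! ### The Lovász number and the main bounds -/

section Lovasz

/-- The rows of a factor of the Gram matrix will do. Representations may therefore be built in any
real inner product space, and a fixed dimension suffices for compactness. -/
theorem exists_euclidean_gram_eq {ι E : Type*} [Fintype ι] [DecidableEq ι] [NormedAddCommGroup E]
    [InnerProductSpace ℝ E] (x : ι → E) :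
    ∃ y : ι → EuclideanSpace ℝ (Fin (Fintype.card ι)),
      ∀ i j, inner ℝ (y i) (y j) = inner ℝ (x i) (x j) := by
  obtain ⟨X, hX⟩ := (posSemidef_gram ℝ x).exists_eq_mul_conjTranspose
  refine ⟨fun i => WithLp.toLp 2 fun k => X i ((Fintype.equivFin ι).symm k), fun i j => ?_⟩
  have h : inner ℝ (x i) (x j) = (X * Xᴴ) i j := by rw [← hX, gram_apply]
  rw [h, mul_apply, PiLp.inner_apply, ← (Fintype.equivFin ι).symm.sum_comp]
  simp [mul_comm]

variable {V : Type*} {G : SimpleGraph V}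

theorem norm_eq_of_inner_self_eq {E F : Type*} [NormedAddCommGroup E] [InnerProductSpace ℝ E]
    [NormedAddCommGroup F] [InnerProductSpace ℝ F] {x : E} {y : F}
    (h : inner ℝ x x = inner ℝ y y) : ‖x‖ = ‖y‖ := by
  rw [norm_eq_sqrt_real_inner, norm_eq_sqrt_real_inner, h]

theorem lovaszTheta_le [Fintype V] [DecidableEq V] {E : Type*} [NormedAddCommGroup E]
    [InnerProductSpace ℝ E] {u : V → E} {c : E} {t : ℝ} (hu : ∀ i, ‖u i‖ = 1)
    (horth : ∀ i j, i ≠ j → ¬ G.Adj i j → inner ℝ (u i) (u j) = 0) (hc : ‖c‖ = 1) (ht : 0 < t)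
    (h : ∀ i, 1 / t ≤ (inner ℝ c (u i)) ^ 2) : lovaszTheta G ≤ t := by
  obtain ⟨y, hy⟩ := exists_euclidean_gram_eq (fun o : Option V => o.elim c u)
  have hpos : ∀ i, 0 < (inner ℝ c (u i)) ^ 2 := fun i => (by positivity : 0 < 1 / t).trans_le (h i)
  refine le_trans (b := ⨆ i, 1 / (inner ℝ (y none) (y (some i))) ^ 2)
    (csInf_le ⟨0, ?_⟩ ⟨_, fun i => y (some i), y none, ⟨fun i => ?_, fun i j hij hG => ?_⟩,
      ?_, fun i => ?_, rfl⟩) (Real.iSup_le (fun i => ?_) ht.le)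
  · rintro _ ⟨d, u, c, -, -, -, rfl⟩
    exact Real.iSup_nonneg fun i => by positivity
  · rw [norm_eq_of_inner_self_eq (hy (some i) (some i))]; exact hu i
  · rw [hy]; exact horth i j hij hG
  · rw [norm_eq_of_inner_self_eq (hy none none)]; exact hc
  · rw [hy]
    intro h0
    have := hpos i
    simp only [Option.elim_none, Option.elim_some] at h0
    simp [h0] at this
  · rw [hy]
    exact (one_div_le (hpos i) ht).2 (h i)

/-- The minimum in the definition of the Lovász number is attained. -/
theorem exists_lovaszTheta_rep [Fintype V] [DecidableEq V] [Nonempty V] (G : SimpleGraph V) :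
    1 ≤ lovaszTheta G ∧ ∃ (d : ℕ) (u : V → EuclideanSpace ℝ (Fin d)) (c : EuclideanSpace ℝ (Fin d)),
      IsOrthonormalRep G u ∧ ‖c‖ = 1 ∧ ∀ i, 1 / lovaszTheta G ≤ (inner ℝ c (u i)) ^ 2 := by
  -- The index `none` carries the handle `c`; the Gram matrix argument moves every representation to
  -- dimension `|V| + 1`.
  let T := Option V → EuclideanSpace ℝ (Fin (Fintype.card (Option V)))
  let S : Set T := {x | (∀ o, ‖x o‖ = 1) ∧
    ∀ i j, i ≠ j → ¬ G.Adj i j → inner ℝ (x (some i)) (x (some j)) = 0}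
  let g : T → ℝ := fun x => Finset.univ.inf' Finset.univ_nonempty
    fun i : V => (inner ℝ (x none) (x (some i))) ^ 2
  have hS : IsCompact S := by
    have h1 : IsCompact (Set.pi Set.univ fun _ : Option V =>
        Metric.sphere (0 : EuclideanSpace ℝ (Fin (Fintype.card (Option V)))) 1) :=
      isCompact_univ_pi fun _ => isCompact_sphere _ _
    refine h1.of_isClosed_subset ?_ fun x hx o _ => by simpa using hx.1 o
    have e : S = (⋂ o, {x : T | ‖x o‖ = 1}) ∩
        ⋂ (i) (j) (_ : i ≠ j) (_ : ¬ G.Adj i j), {x : T | inner ℝ (x (some i)) (x (some j)) = 0} := by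
      ext x; simp [S]
    rw [e]
    refine (isClosed_iInter fun o => isClosed_eq (by fun_prop) continuous_const).inter
      (isClosed_iInter fun i => isClosed_iInter fun j => isClosed_iInter fun _ =>
        isClosed_iInter fun _ => isClosed_eq (by fun_prop) continuous_const)
  have hg : Continuous g := Continuous.finset_inf'_apply _ fun i _ => by fun_prop
  have transfer : ∀ {d : ℕ} (u : V → EuclideanSpace ℝ (Fin d)) (c : EuclideanSpace ℝ (Fin d)),
      IsOrthonormalRep G u → ‖c‖ = 1 →
      ∃ x ∈ S, ∀ i, inner ℝ (x none) (x (some i)) = inner ℝ c (u i) := by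
    intro d u c hu hc
    obtain ⟨y, hy⟩ := exists_euclidean_gram_eq (fun o : Option V => o.elim c u)
    refine ⟨y, ⟨?_, fun i j hij hG => ?_⟩, fun i => hy none (some i)⟩
    · rintro (_ | i)
      · rw [norm_eq_of_inner_self_eq (hy none none)]; exact hc
      · rw [norm_eq_of_inner_self_eq (hy (some i) (some i))]; exact hu.1 i
    · rw [hy]; exact hu.2 i j hij hG
  obtain ⟨d₀, u₀, c₀, hu₀, hc₀, hpos₀⟩ : ∃ (d : ℕ) (u : V → EuclideanSpace ℝ (Fin d))
      (c : EuclideanSpace ℝ (Fin d)), IsOrthonormalRep G u ∧ ‖c‖ = 1 ∧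
      ∀ i, inner ℝ c (u i) ≠ 0 := by
    -- An orthonormal basis with the uniform handle is admissible for every graph, so the maximum of
    -- `g` is positive.
    let e := Fintype.equivFin V
    have hn : (0 : ℝ) < Fintype.card V := by exact_mod_cast Fintype.card_pos
    refine ⟨Fintype.card V, fun i => EuclideanSpace.single (e i) 1,
      WithLp.toLp 2 fun _ => (√(Fintype.card V))⁻¹, ⟨fun i => by simp, fun i j hij _ => ?_⟩, ?_,
      fun i => ?_⟩
    · simp [EuclideanSpace.inner_single_left, hij]
    · rw [EuclideanSpace.norm_eq]
      simp [hn.le, hn.ne']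
    · simp [EuclideanSpace.inner_single_right]
  obtain ⟨x₀, hx₀, hi₀⟩ := transfer u₀ c₀ hu₀ hc₀
  obtain ⟨x, hx, hmax⟩ := hS.exists_isMaxOn ⟨x₀, hx₀⟩ hg.continuousOn
  have hm : 0 < g x := by
    refine lt_of_lt_of_le ?_ (hmax hx₀)
    refine (Finset.lt_inf'_iff _).2 fun i _ => ?_
    rw [hi₀]
    have := hpos₀ i
    positivity
  have hle : 1 / g x ≤ lovaszTheta G := by
    refine le_csInf ⟨_, d₀, u₀, c₀, hu₀, hc₀, hpos₀, rfl⟩ ?_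
    rintro _ ⟨d, u, c, hu, hc, hne, rfl⟩
    obtain ⟨y, hy, hyi⟩ := transfer u c hu hc
    obtain ⟨i, -, hi⟩ := Finset.exists_mem_eq_inf' Finset.univ_nonempty
      fun i : V => (inner ℝ (y none) (y (some i))) ^ 2
    have h1 : (inner ℝ c (u i)) ^ 2 ≤ g x := by
      rw [← hyi, ← hi]; exact hmax hy
    have h2 : 0 < (inner ℝ c (u i)) ^ 2 := by
      have := hne i
      positivity
    exact (one_div_le_one_div_of_le h2 h1).trans
      (le_ciSup (f := fun i => 1 / (inner ℝ c (u i)) ^ 2) (Set.finite_range _).bddAbove i)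
  have hgi : ∀ i, g x ≤ (inner ℝ (x none) (x (some i))) ^ 2 := fun i =>
    Finset.inf'_le _ (Finset.mem_univ i)
  have h1 : 1 ≤ lovaszTheta G := by
    refine le_trans ?_ hle
    rw [one_le_div hm]
    obtain ⟨i⟩ := ‹Nonempty V›
    refine (hgi i).trans ?_
    have := abs_real_inner_le_norm (x none) (x (some i))
    rw [hx.1, hx.1, one_mul] at this
    rwa [sq_le_one_iff_abs_le_one]
  refine ⟨h1, _, fun i => x (some i), x none, ⟨fun i => hx.1 _, hx.2⟩, hx.1 _, fun i => ?_⟩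
  exact ((one_div_le hm (by linarith)).1 hle).trans (hgi i)

/-- In the orthogonal sum of optimal representations, handle weights `s / (s + t)` and `t / (s + t)`
equalise the two guarantees: `s / (s + t) * (1 / s) = 1 / (s + t)`. -/
theorem lovaszTheta_sum_le {W : Type*} [Fintype V] [DecidableEq V] [Nonempty V] [Fintype W]
    [DecidableEq W] [Nonempty W] (G : SimpleGraph V) (H : SimpleGraph W) :
    lovaszTheta (G ⊕g H) ≤ lovaszTheta G + lovaszTheta H := by
  obtain ⟨h1, d₁, u₁, c₁, hu₁, hc₁, hi₁⟩ := exists_lovaszTheta_rep G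
  obtain ⟨h2, d₂, u₂, c₂, hu₂, hc₂, hi₂⟩ := exists_lovaszTheta_rep H
  set s := lovaszTheta G
  set t := lovaszTheta H
  have hst : 0 < s + t := by linarith
  refine lovaszTheta_le
    (E := WithLp 2 (EuclideanSpace ℝ (Fin d₁) × EuclideanSpace ℝ (Fin d₂)))
    (u := Sum.elim (fun i => WithLp.toLp 2 (u₁ i, 0)) (fun i => WithLp.toLp 2 (0, u₂ i)))
    (c := WithLp.toLp 2 (√(s / (s + t)) • c₁, √(t / (s + t)) • c₂)) ?_ ?_ ?_ hst ?_
  · rintro (i | i)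
    · simp [hu₁.1]
    · simp [hu₂.1]
  · rintro (i | i) (j | j) hij hG
    · simpa using hu₁.2 i j (by simpa using hij) (by simpa using hG)
    · simp
    · simp
    · simpa using hu₂.2 i j (by simpa using hij) (by simpa using hG)
  · have hs : 0 ≤ s / (s + t) := by positivity
    have ht : 0 ≤ t / (s + t) := by positivity
    rw [WithLp.prod_norm_eq_of_L2]
    simp only [WithLp.toLp_fst, WithLp.toLp_snd, norm_smul, hc₁, hc₂, mul_one,
      Real.norm_eq_abs, sq_abs, Real.sq_sqrt hs,
      Real.sq_sqrt ht]
    rw [← add_div, div_self hst.ne', Real.sqrt_one]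
  · have key : ∀ a x : ℝ, 1 ≤ a → 1 / a ≤ x ^ 2 → 1 / (s + t) ≤ (√(a / (s + t)) * x) ^ 2 := by
      intro a x ha hx
      have ha' : 0 < a := by linarith
      rw [mul_pow, Real.sq_sqrt (by positivity)]
      calc 1 / (s + t) = a / (s + t) * (1 / a) := by field_simp
        _ ≤ _ := by gcongr
    rintro (i | i)
    · simpa [real_inner_smul_left] using key s _ h1 (hi₁ i)
    · simpa [real_inner_smul_left] using key t _ h2 (hi₂ i)

variable [Fintype V] [DecidableEq V] {B : Type*} [Fintype B] [DecidableEq B]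

/-- In the real Hilbert–Schmidt space take the normalised `P i * X` with handle `X`. Since `P i` is
a projection, the squared overlap is `‖P i * X‖² = Tr (X† P i X)`. -/
theorem lovaszTheta_le_of_state {P : V → Matrix B B ℂ} (hPh : ∀ i, (P i).IsHermitian)
    (hPP : ∀ i, P i * P i = P i) (horth : ∀ i j, i ≠ j → ¬ G.Adj i j → P i * P j = 0)
    {X : Matrix B B ℂ} (hX : (Xᴴ * X).trace = 1) {α : ℝ} (hα : 0 < α)
    (h : ∀ i, 1 / α ≤ (Xᴴ * P i * X).trace.re) : lovaszTheta G ≤ α := by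
  let vec : Matrix B B ℂ → EuclideanSpace ℂ (B × B) := fun Y => WithLp.toLp 2 fun p => Y p.1 p.2
  have hinner : ∀ Y Z, inner ℝ (vec Y) (vec Z) = (Yᴴ * Z).trace.re := by
    intro Y Z
    simp only [PiLp.inner_apply, Fintype.sum_prod_type, trace, diag_apply, mul_apply,
      conjTranspose_apply, vec, Complex.re_sum, Complex.inner]
    rw [Finset.sum_comm]
    simp [mul_comm]
  have hPPX : ∀ i j, (P i * X)ᴴ * (P j * X) = Xᴴ * (P i * P j) * X := by
    intro i j
    rw [conjTranspose_mul, (hPh i).eq]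
    simp only [mul_assoc]
  have hsq : ∀ i, ‖vec (P i * X)‖ ^ 2 = (Xᴴ * P i * X).trace.re := by
    intro i
    rw [← real_inner_self_eq_norm_sq, hinner, hPPX, hPP]
  have hpos : ∀ i, 0 < ‖vec (P i * X)‖ := by
    intro i
    have h1 : 0 < ‖vec (P i * X)‖ ^ 2 := by
      rw [hsq]; exact (by positivity : 0 < 1 / α).trans_le (h i)
    exact (norm_nonneg _).lt_of_ne fun h0 => by simp [← h0] at h1
  refine lovaszTheta_le (u := fun i => ‖vec (P i * X)‖⁻¹ • vec (P i * X)) (c := vec X)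
    (fun i => ?_) (fun i j hij hG => ?_) ?_ hα fun i => ?_
  · rw [norm_smul, norm_inv, norm_norm, inv_mul_cancel₀ (hpos i).ne']
  · rw [real_inner_smul_left, real_inner_smul_right, hinner, hPPX, horth i j hij hG]
    simp
  · rw [norm_eq_sqrt_real_inner, hinner, hX]
    simp
  · rw [real_inner_smul_right, hinner, ← mul_assoc, ← hsq, sq ‖_‖, ← mul_assoc,
      inv_mul_cancel₀ (hpos i).ne', one_mul, hsq]
    exact h i

/-- The extra bound `1 ≤ ∑ s i` is what the completion of two packings needs; for `α < 1` a single
unit weight supplies it. -/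
theorem exists_packing_of_lt_lovaszTheta [Nonempty V] {P : V → Matrix B B ℂ}
    (hPh : ∀ i, (P i).IsHermitian) (hPP : ∀ i, P i * P i = P i) (hP0 : ∀ i, P i ≠ 0)
    (horth : ∀ i j, i ≠ j → ¬ G.Adj i j → P i * P j = 0) {α : ℝ} (hα : α < lovaszTheta G) :
    ∃ s, IsPacking P s ∧ α ≤ ∑ i, s i ∧ 1 ≤ ∑ i, s i := by
  obtain ⟨i⟩ := ‹Nonempty V›
  rcases lt_or_ge α 1 with h1 | h1
  · refine ⟨_, isPacking_single (hPh i) (hPP i), ?_⟩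
    simp [h1.le]
  · have : Nonempty B := by
      by_contra hB
      rw [not_nonempty_iff] at hB
      exact hP0 i (Subsingleton.elim _ _)
    rcases exists_state_or_exists_packing
      (fun i => posSemidef_of_projection (hPh i) (hPP i)) (zero_lt_one.trans_le h1) with
      ⟨X, hX, h⟩ | ⟨s, hs, h⟩
    · exact absurd (lovaszTheta_le_of_state hPh hPP horth hX (zero_lt_one.trans_le h1) h) hα.not_ge
    · exact ⟨s, hs, h.le, h1.trans h.le⟩

theorem IsCQGraph.lovaszTheta_le_packingNumber [Nonempty V] {K : Submodule ℂ (Matrix B V ℂ)}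
    (hK : IsCQGraph K) (hG : adjointProduct K ≤ graphSpace G) :
    lovaszTheta G ≤ packingNumber K := by
  refine le_of_forall_lt_imp_le_of_dense fun α hα => ?_
  obtain ⟨s, hs, h, -⟩ := exists_packing_of_lt_lovaszTheta (choiBlock_isHermitian K)
    hK.choiBlock_mul_self hK.choiBlock_ne_zero
    (fun i j hij hadj => choiBlock_mul_choiBlock hG hij hadj) hα
  exact h.trans (hK.le_packingNumber hs)

/-- Take the pure output states `|u i⟩⟨u i|` of an optimal representation. Testing `∑ s i • P i ≤ 1`
on the handle `c` gives `∑ s i / ϑ(G) ≤ 1`. -/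
theorem exists_cqGraph_packingNumber_le [Nonempty V] (G : SimpleGraph V) :
    ∃ (d : ℕ) (K : Submodule ℂ (Matrix (Fin d) V ℂ)),
      IsCQGraph K ∧ adjointProduct K ≤ graphSpace G ∧ packingNumber K ≤ lovaszTheta G := by
  obtain ⟨hθ, d, u, c, hu, hc, hi⟩ := exists_lovaszTheta_rep G
  have hθ0 : 0 < lovaszTheta G := by linarith
  let w : V → Fin d → ℂ := fun i b => (u i b : ℂ)
  let c' : Fin d → ℂ := fun b => (c b : ℂ)
  have hw : ∀ i, star (w i) = w i := fun i => by ext b; simp [w]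
  have hc'' : star c' = c' := by ext b; simp [c']
  have hdot : ∀ x y : EuclideanSpace ℝ (Fin d),
      (fun b => (x b : ℂ)) ⬝ᵥ (fun b => (y b : ℂ)) = ((inner ℝ x y : ℝ) : ℂ) := by
    intro x y
    simp [dotProduct, PiLp.inner_apply, mul_comm]
  have hww : ∀ i, w i ⬝ᵥ w i = 1 := by
    intro i
    rw [hdot, real_inner_self_eq_norm_sq, hu.1]; simp
  let e := Fintype.equivFin V
  let E : Fin (Fintype.card V) → Matrix (Fin d) V ℂ := fun k =>
    vecMulVec (w (e.symm k)) (Pi.single (e.symm k) 1)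
  have hK : IsCQGraph (Submodule.span ℂ (Set.range E)) := by
    refine ⟨fun i => vecMulVec (w i) (star (w i)), fun i => ⟨posSemidef_vecMulVec_self_star _, ?_⟩,
      _, E, fun ρ => ?_, rfl⟩
    · rw [trace_vecMulVec, hw, hww]
    · rw [← e.symm.sum_comp]
      refine Finset.sum_congr rfl fun k _ => ?_
      have hρ : Pi.single (e.symm k) 1 ᵥ* ρ ⬝ᵥ star (Pi.single (e.symm k) 1)
          = ρ (e.symm k) (e.symm k) := by
        rw [← Pi.single_star, star_one, dotProduct_single, mul_one, single_one_vecMul]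
        rfl
      simp only [E]
      rw [conjTranspose_vecMulVec, vecMulVec_mul, vecMulVec_mul_vecMulVec, hρ]
      ext b b'
      simp only [vecMulVec_apply, Matrix.smul_apply, Pi.smul_apply, smul_eq_mul]
      ring
  refine ⟨d, Submodule.span ℂ (Set.range E), hK, ?_, hK.packingNumber_le hθ0.le fun s hs => ?_⟩
  · have hcol : ∀ X ∈ Submodule.span ℂ (Set.range E), ∀ i, ∃ r : ℂ, ∀ b, X b i = r * w i b := by
      intro X hX i
      induction hX using Submodule.span_induction with
      | mem x hx =>
        obtain ⟨k, rfl⟩ := hx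
        by_cases hk : i = e.symm k
        · exact ⟨1, fun b => by simp [E, vecMulVec_apply, hk]⟩
        · exact ⟨0, fun b => by simp [E, vecMulVec_apply, hk]⟩
      | zero => exact ⟨0, fun b => by simp⟩
      | add x y _ _ hx hy =>
        obtain ⟨p, hp⟩ := hx
        obtain ⟨q, hq⟩ := hy
        exact ⟨p + q, fun b => by rw [Matrix.add_apply, hp, hq, add_mul]⟩
      | smul r x _ hx =>
        obtain ⟨p, hp⟩ := hx
        exact ⟨r * p, fun b => by rw [Matrix.smul_apply, hp, smul_eq_mul, mul_assoc]⟩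
    refine Submodule.span_le.2 ?_
    rintro _ ⟨X, hX, Y, hY, rfl⟩
    refine mem_graphSpace_iff.2 fun i j hij hG => ?_
    obtain ⟨p, hp⟩ := hcol X hX i
    obtain ⟨q, hq⟩ := hcol Y hY j
    have h0 : w i ⬝ᵥ w j = 0 := by rw [hdot, hu.2 i j hij hG]; simp
    have : (Xᴴ * Y) i j = star p * q * (w i ⬝ᵥ w j) := by
      simp only [mul_apply, conjTranspose_apply, hp, hq, dotProduct, Finset.mul_sum]
      refine Finset.sum_congr rfl fun b _ => ?_
      rw [star_mul', show star (w i b) = w i b from congrFun (hw i) b]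
      ring
    rw [this, h0, mul_zero]
  · set K := Submodule.span ℂ (Set.range E)
    have hPw : ∀ i, choiBlock K i *ᵥ w i = w i := by
      intro i
      have h := hK.choiBlock_mulVec_of_mem (Submodule.subset_span ⟨e i, rfl⟩) i
      simpa [E, vecMulVec_apply] using h
    have hwP : ∀ i, w i ᵥ* choiBlock K i = w i := by
      intro i
      have h := congrArg star (hPw i)
      rwa [star_mulVec, (choiBlock_isHermitian K i).eq, hw] at h
    -- Only `P i ≥ |u i⟩⟨u i|` is needed: the difference is a projection because `P i` fixes `u i`.
    have hsub : ∀ i, (choiBlock K i - vecMulVec (w i) (w i)).PosSemidef := by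
      intro i
      refine posSemidef_of_projection ((choiBlock_isHermitian K i).sub ?_) ?_
      · rw [IsHermitian, conjTranspose_vecMulVec, hw]
      · rw [mul_sub, sub_mul, sub_mul, hK.choiBlock_mul_self, mul_vecMulVec, vecMulVec_mul,
          vecMulVec_mul_vecMulVec, hPw, hwP, hww, one_smul]
        simp
    have hlow : ∀ i, 1 / lovaszTheta G ≤ (c' ⬝ᵥ (choiBlock K i *ᵥ c')).re := by
      intro i
      have h := (hsub i).dotProduct_mulVec_nonneg c'
      rw [hc'', sub_mulVec, dotProduct_sub, vecMulVec_mulVec, dotProduct_smul, hdot, hdot] at h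
      have h1 := (Complex.nonneg_iff.1 h).1
      rw [real_inner_comm c (u i)] at h1
      simp [← Complex.ofReal_mul] at h1
      have := hi i
      rw [sq] at this
      linarith
    have h := hs.2.dotProduct_mulVec_nonneg c'
    rw [hc'', sub_mulVec, dotProduct_sub, one_mulVec, hdot, real_inner_self_eq_norm_sq, hc,
      Matrix.sum_mulVec, dotProduct_sum] at h
    have h1 := (Complex.nonneg_iff.1 h).1
    simp only [smul_mulVec, dotProduct_smul, smul_eq_mul, Complex.sub_re, Complex.re_sum,
      Complex.re_ofReal_mul, Complex.ofReal_re] at h1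
    have h2 : ∑ i, s i * (1 / lovaszTheta G) ≤ 1 := by
      refine (Finset.sum_le_sum fun i _ => mul_le_mul_of_nonneg_left (hlow i) (hs.1 i)).trans ?_
      linarith
    rw [← Finset.sum_mul, mul_one_div, div_le_one hθ0] at h2
    exact h2

theorem isLeast_packingValues [Nonempty V] (G : SimpleGraph V) :
    IsLeast (packingValues G) (lovaszTheta G) := by
  refine ⟨?_, ?_⟩
  · obtain ⟨d, K, hK, hG, h⟩ := exists_cqGraph_packingNumber_le G
    exact ⟨d, K, hK, hG, le_antisymm (hK.lovaszTheta_le_packingNumber hG) h⟩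
  · rintro _ ⟨d, K, hK, hG, rfl⟩
    exact hK.lovaszTheta_le_packingNumber hG

theorem IsCQGraph.lovaszTheta_add_le_upsilon {W : Type*} [Fintype W] [DecidableEq W] [Nonempty V]
    [Nonempty W] {G : SimpleGraph V} {H : SimpleGraph W} {K : Submodule ℂ (Matrix B (V ⊕ W) ℂ)}
    (hK : IsCQGraph K) (hG : adjointProduct K ≤ graphSpace (G ⊕g H)) :
    lovaszTheta G + lovaszTheta H ≤ upsilon K := by
  have h : ∀ α < lovaszTheta G, ∀ β < lovaszTheta H, α + β ≤ upsilon K := by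
    intro α hα β hβ
    obtain ⟨s, hs, hsα, hs1⟩ := exists_packing_of_lt_lovaszTheta
      (P := fun v => choiBlock K (.inl v)) (fun _ => choiBlock_isHermitian K _)
      (fun _ => hK.choiBlock_mul_self _) (fun _ => hK.choiBlock_ne_zero _)
      (fun i j hij hadj => choiBlock_mul_choiBlock hG (by simpa using hij) (by simpa using hadj)) hα
    obtain ⟨t, ht, htβ, ht1⟩ := exists_packing_of_lt_lovaszTheta
      (P := fun w => choiBlock K (.inr w)) (fun _ => choiBlock_isHermitian K _)
      (fun _ => hK.choiBlock_mul_self _) (fun _ => hK.choiBlock_ne_zero _)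
      (fun i j hij hadj => choiBlock_mul_choiBlock hG (by simpa using hij) (by simpa using hadj)) hβ
    have := hK.add_le_upsilon (fun v w => choiBlock_mul_choiBlock hG (by simp) (by simp)) hs ht
      hs1 ht1
    linarith
  -- Packings are available only strictly below each Lovász number, so the two limits are taken one
  -- after the other.
  rw [← le_sub_iff_add_le]
  refine le_of_forall_lt_imp_le_of_dense fun α hα => ?_
  rw [le_sub_comm]
  refine le_of_forall_lt_imp_le_of_dense fun β hβ => ?_
  linarith [h α hα β hβ]

/-- A cq-graph with optimal packing number for the disjoint union also attains the minimum of `Υ`,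
since its `Υ` is squeezed between the two bounds. -/
theorem isLeast_upsilonValues_sum {W : Type*} [Fintype W] [DecidableEq W] [Nonempty V] [Nonempty W]
    (G : SimpleGraph V) (H : SimpleGraph W) :
    IsLeast (upsilonValues (G ⊕g H)) (lovaszTheta G + lovaszTheta H) := by
  refine ⟨?_, ?_⟩
  · obtain ⟨d, K, hK, hG, h⟩ := exists_cqGraph_packingNumber_le (G ⊕g H)
    exact ⟨d, K, hK, hG, le_antisymm (hK.lovaszTheta_add_le_upsilon hG)
      (hK.upsilon_le_packingNumber.trans (h.trans (lovaszTheta_sum_le G H)))⟩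
  · rintro _ ⟨d, K, hK, hG, rfl⟩
    exact hK.lovaszTheta_add_le_upsilon hG

end Lovasz

end ZeroError

theorem mainTheorem9 {V W : Type*} [Fintype V] [DecidableEq V] [Nonempty V]
    [Fintype W] [DecidableEq W] [Nonempty W] (G₁ : SimpleGraph V) (G₂ : SimpleGraph W) :
    IsLeast (ZeroError.packingValues G₁) (ZeroError.lovaszTheta G₁) ∧
    IsLeast (ZeroError.packingValues G₂) (ZeroError.lovaszTheta G₂) ∧
    IsLeast (ZeroError.upsilonValues (G₁ ⊕g G₂)) (ZeroError.graphUpsilon (G₁ ⊕g G₂)) ∧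
    ZeroError.graphUpsilon (G₁ ⊕g G₂) =
      ZeroError.lovaszTheta G₁ + ZeroError.lovaszTheta G₂ := by
  have h := ZeroError.isLeast_upsilonValues_sum G₁ G₂
  have e : ZeroError.graphUpsilon (G₁ ⊕g G₂) =
      ZeroError.lovaszTheta G₁ + ZeroError.lovaszTheta G₂ := h.csInf_eq
  exact ⟨ZeroError.isLeast_packingValues G₁, ZeroError.isLeast_packingValues G₂, e ▸ h, e⟩
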